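/- Let $\mathcal D$ be a category. Write $[n]=\{0<1<\dots<n\}$, and let $[-1]$ be the empty category. The suspension of $\mathcal D$ is the strict $2$-category $\Sigma\mathcal D$ with two objects $x,y$ and hom categories $\mathrm{Hom}(x,y)=\mathcal D$, $\mathrm{Hom}(y,x)=[-1]$, $\mathrm{Hom}(x,x)=\mathrm{Hom}(y,y)=[0]$. The Duskin nerve $N(\mathcal C)$ of a $2$-category $\mathcal C$ is the simplicial set whose $n$-simplices are the normal (strictly unitary) oplax functors $\sigma\colon[n]\to\mathcal C$: objects $\sigma(i)$, $1$-morphisms $\sigma_{ij}\colon\sigma(i)\to\sigma(j)$ for $i\le j$, and $2$-cells $\sigma_{ik}\Rightarrow\sigma_{jk}\circ\sigma_{ij}$ for $i\le j\le k$, trivial on degenerate edges and triangles, which satisfy the tetrahedron relation for all $i\le j\le k\le l$. Let $\mathrm{Mat}(\mathcal D)$ be the simplicial set whose $n$-simplices are the triples $(k,l,\sigma)$ with $k,l\ge-1$, $k+l=n-1$ and $\sigma\colon[k]\times[l]^{\mathrm{op}}\to\mathcal D$ a functor, with \[ d_i\sigma=\begin{cases}\sigma\,(d^i\times\mathrm{id})\colon[k-1]\times[l]^{\mathrm{op}}\to\mathcal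 D & 0\le i\le k,\\ \sigma\,(\mathrm{id}\times d^{\,i-(k+1)})\colon[k]\times[l-1]^{\mathrm{op}}\to\mathcal D& k+1\le i\le n,\end{cases} \] for $n\ge1$, and \[ s_i\sigma=\begin{cases}\sigma\,(s^i\times\mathrm{id})\colon[k+1]\times[l]^{\mathrm{op}}\to\mathcal D & 0\le i\le k,\\ \sigma\,(\mathrm{id}\times s^{\,i-(k+1)})\colon[k]\times[l+1]^{\mathrm{op}}\to\mathcal D& k+1\le i\le n\end{cases} \] (delete, respectively double, a row or a column). For $-1\le k\le n$ let $\chi_k\in\Delta[1]_n$ be the map $[n]\to[1]$ with $\chi_k(i)=0$ if and only if $i\le k$. Let $q\colon\mathrm{Mat}(\mathcal D)\to\Delta[1]$ be given by $(k,l,\sigma)\mapsto\chi_k$, and let $p\colon N(\Sigma\mathcal D)\to\Delta[1]$ be the map induced by the canonical $2$-functor $\Sigma\mathcal D\to[1]$, $x\mapsto0$, $y\mapsto1$. An $n$-simplex of $N(\Sigma\mathcal D)$ is of type $k$, for $0\le k\le n-1$, if its edge $(k,k+1)$ is non-degenerate; the simplices of type $-1$ and of type $n$ are those that are degeneracies of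 the $0$-simplices $y$ and $x$, respectively (for $n=0$, these $0$-simplices themselves). **Theorem.** There is an isomorphism of simplicial sets $\Phi\colon\mathrm{Mat}(\mathcal D)\cong N(\Sigma\mathcal D)$ over $\Delta[1]$, that is, with $p\circ\Phi=q$. In particular, every $n$-simplex of $N(\Sigma\mathcal D)$ is $\Phi(k,l,\sigma)$ for a unique triple $(k,l,\sigma)$ as above, and for every $-1\le k\le n$ the assignment $\sigma\mapsto\Phi(k,n-1-k,\sigma)$ is a bijection from the functors $[k]\times[n-1-k]^{\mathrm{op}}\to\mathcal D$ to the $n$-simplices of $N(\Sigma\mathcal D)$ of type $k$. -/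

import Mathlib

open CategoryTheory Opposite

universe w v u

namespace DuskinNerve

/-! ### The Duskin nerve -/

section Nerve

open Bicategory

/-- An `n`-simplex of the Duskin nerve of `C`: a normal (strictly unitary) oplax functor from the
poset `[n]` to `C`. It consists of objects `obj i`, of `1`-morphisms `map i j : obj i ⟶ obj j` for
`i ≤ j` and of `2`-cells `map i k ⟶ map i j ≫ map j k` for `i ≤ j ≤ k` which are trivial on
degenerate edges and triangles and which satisfy the tetrahedron relation for `i ≤ j ≤ k ≤ l`. -/
@[ext]
structure Simplex (C : Type u) [Bicategory.{w, v} C] (n : ℕ) where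
  obj : Fin (n + 1) → C
  map : ∀ i j : Fin (n + 1), i ≤ j → (obj i ⟶ obj j)
  cell : ∀ (i j k : Fin (n + 1)) (hij : i ≤ j) (hjk : j ≤ k),
    map i k (hij.trans hjk) ⟶ map i j hij ≫ map j k hjk
  map_self : ∀ i : Fin (n + 1), map i i le_rfl = 𝟙 (obj i)
  cell_left : ∀ (i j : Fin (n + 1)) (hij : i ≤ j),
    cell i i j le_rfl hij ≫ eqToHom (map_self i) ▷ map i j hij ≫ (λ_ (map i j hij)).hom =
      𝟙 (map i j hij)
  cell_right : ∀ (i j : Fin (n + 1)) (hij : i ≤ j),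
    cell i j j hij le_rfl ≫ map i j hij ◁ eqToHom (map_self j) ≫ (ρ_ (map i j hij)).hom =
      𝟙 (map i j hij)
  tetrahedron : ∀ (i j k l : Fin (n + 1)) (hij : i ≤ j) (hjk : j ≤ k) (hkl : k ≤ l),
    cell i k l (hij.trans hjk) hkl ≫ cell i j k hij hjk ▷ map k l hkl ≫
        (α_ (map i j hij) (map j k hjk) (map k l hkl)).hom =
      cell i j l hij (hjk.trans hkl) ≫ map i j hij ◁ cell j k l hjk hkl

variable {C : Type u} [Bicategory.{w, v} C]

/-- Precomposition of a simplex with a monotone map `[m] → [n]`. -/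
def Simplex.reindex {m n : ℕ} (s : Simplex C n) (θ : Fin (m + 1) →o Fin (n + 1)) :
    Simplex C m where
  obj i := s.obj (θ i)
  map i j h := s.map (θ i) (θ j) (θ.monotone h)
  cell i j k hij hjk := s.cell (θ i) (θ j) (θ k) (θ.monotone hij) (θ.monotone hjk)
  map_self i := s.map_self (θ i)
  cell_left i j hij := s.cell_left (θ i) (θ j) (θ.monotone hij)
  cell_right i j hij := s.cell_right (θ i) (θ j) (θ.monotone hij)
  tetrahedron i j k l hij hjk hkl :=
    s.tetrahedron (θ i) (θ j) (θ k) (θ l) (θ.monotone hij) (θ.monotone hjk) (θ.monotone hkl)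

variable (C) in
/-- The Duskin nerve of a `2`-category. -/
def duskinNerve : SSet.{max u v w} where
  obj n := Simplex C n.unop.len
  map θ := TypeCat.ofHom fun s ↦ s.reindex θ.unop.toOrderHom
  map_id _ := rfl
  map_comp _ _ := rfl

end Nerve

/-! ### The suspension of a category -/

/-- The objects of the suspension `2`-category `ΣD`. -/
inductive Suspension (D : Type u) : Type
  | x
  | y

namespace Suspension

variable (D : Type u)

/-- The `1`-morphisms of `ΣD`: the hom from `x` to `y` is `D`, the hom from `y` to `x` is empty, and
the endomorphisms of `x` and of `y` are trivial. -/
def Hom : Suspension D → Suspension D → Type u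
  | x, y => D
  | y, x => PEmpty
  | x, x => PUnit
  | y, y => PUnit

/-- The hom categories of `ΣD`: the category `D`, the empty category, and the terminal category. -/
instance homCategory [Category.{v} D] : ∀ a b : Suspension D, Category.{v} (Hom D a b)
  | x, y => inferInstanceAs (Category.{v} D)
  | y, x =>
    { Hom := fun _ _ ↦ PEmpty
      id := fun f ↦ PEmpty.elim f
      comp := fun f _ ↦ f
      id_comp := fun f ↦ PEmpty.elim f
      comp_id := fun f ↦ PEmpty.elim f
      assoc := fun f _ _ ↦ PEmpty.elim f }
  | x, x =>
    { Hom := fun _ _ ↦ PUnit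
      id := fun _ ↦ PUnit.unit
      comp := fun _ _ ↦ PUnit.unit }
  | y, y =>
    { Hom := fun _ _ ↦ PUnit
      id := fun _ ↦ PUnit.unit
      comp := fun _ _ ↦ PUnit.unit }

variable {D}

/-- The identity `1`-morphisms of `ΣD`. -/
def homId : ∀ a : Suspension D, Hom D a a
  | x => PUnit.unit
  | y => PUnit.unit

/-- Composition of `1`-morphisms in `ΣD`. -/
def homComp : ∀ {a b c : Suspension D}, Hom D a b → Hom D b c → Hom D a c
  | x, x, x, _, _ => PUnit.unit
  | x, x, y, _, d => d
  | x, y, y, d, _ => d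
  | y, y, y, _, _ => PUnit.unit
  | y, x, _, f, _ => PEmpty.elim f
  | _, y, x, _, g => PEmpty.elim g

theorem homId_comp : ∀ {a b : Suspension D} (f : Hom D a b), homComp (homId a) f = f
  | x, x, _ => rfl
  | x, y, _ => rfl
  | y, y, _ => rfl
  | y, x, f => PEmpty.elim f

theorem homComp_id : ∀ {a b : Suspension D} (f : Hom D a b), homComp f (homId b) = f
  | x, x, _ => rfl
  | x, y, _ => rfl
  | y, y, _ => rfl
  | y, x, f => PEmpty.elim f

theorem homComp_assoc : ∀ {a b c d : Suspension D} (f : Hom D a b) (g : Hom D b c) (h : Hom D c d),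
    homComp (homComp f g) h = homComp f (homComp g h)
  | x, x, x, x, _, _, _ => rfl
  | x, x, x, y, _, _, _ => rfl
  | x, x, y, y, _, _, _ => rfl
  | x, y, y, y, _, _, _ => rfl
  | y, y, y, y, _, _, _ => rfl
  | y, x, _, _, f, _, _ => PEmpty.elim f
  | _, y, x, _, _, g, _ => PEmpty.elim g
  | _, _, y, x, _, _, h => PEmpty.elim h

variable [Category.{v} D]

/-- Left whiskering of `2`-cells in `ΣD`. -/
def whiskerL : ∀ {a b c : Suspension D} (f : Hom D a b) {g h : Hom D b c},
    (g ⟶ h) → (homComp f g ⟶ homComp f h)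
  | x, x, x, _, _, _, _ => PUnit.unit
  | x, x, y, _, _, _, η => η
  | x, y, y, f, _, _, _ => @CategoryStruct.id D _ f
  | y, y, y, _, _, _, _ => PUnit.unit
  | y, x, _, f, _, _, _ => PEmpty.elim f
  | _, y, x, _, g, _, _ => PEmpty.elim g

/-- Right whiskering of `2`-cells in `ΣD`. -/
def whiskerR : ∀ {a b c : Suspension D} {f g : Hom D a b} (_ : f ⟶ g) (h : Hom D b c),
    (homComp f h ⟶ homComp g h)
  | x, x, x, _, _, _, _ => PUnit.unit
  | x, x, y, _, _, _, h => @CategoryStruct.id D _ h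
  | x, y, y, _, _, η, _ => η
  | y, y, y, _, _, _, _ => PUnit.unit
  | y, x, _, f, _, _, _ => PEmpty.elim f
  | _, y, x, _, _, _, h => PEmpty.elim h

/-- The suspension `2`-category `ΣD`. -/
instance bicategory : Bicategory.{v, u} (Suspension D) where
  Hom := Hom D
  id := homId
  comp := homComp
  homCategory := homCategory D
  whiskerLeft := whiskerL
  whiskerRight := whiskerR
  associator f g h := eqToIso (homComp_assoc f g h)
  leftUnitor f := eqToIso (homId_comp f)
  rightUnitor f := eqToIso (homComp_id f)
  whiskerLeft_id := by
    intro a b c f g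
    cases a <;> cases b <;> cases c <;>
    first
      | rfl
      | exact PEmpty.elim f
      | exact PEmpty.elim g
  whiskerLeft_comp := by
    intro a b c f g h i η θ
    cases a <;> cases b <;> cases c <;>
    first
      | rfl
      | exact PEmpty.elim f
      | exact PEmpty.elim g
      | exact (Category.id_comp (obj := D) _).symm
  id_whiskerLeft := by
    intro a b f g η
    cases a <;> cases b <;>
    first
      | rfl
      | exact PEmpty.elim f
      | exact ((Category.id_comp (obj := D) _).trans (Category.comp_id (obj := D) _)).symm
  comp_whiskerLeft := by
    intro a b c d f g h h' η
    cases a <;> cases b <;> cases c <;> cases d <;>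
    first
      | rfl
      | exact PEmpty.elim f
      | exact PEmpty.elim g
      | exact PEmpty.elim h
      | exact ((Category.id_comp (obj := D) _).trans (Category.comp_id (obj := D) _)).symm
  id_whiskerRight := by
    intro a b c f g
    cases a <;> cases b <;> cases c <;>
    first
      | rfl
      | exact PEmpty.elim f
      | exact PEmpty.elim g
  comp_whiskerRight := by
    intro a b c f g h η θ i
    cases a <;> cases b <;> cases c <;>
    first
      | rfl
      | exact PEmpty.elim f
      | exact PEmpty.elim i
      | exact (Category.id_comp (obj := D) _).symm
  whiskerRight_id := by
    intro a b f g η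
    cases a <;> cases b <;>
    first
      | rfl
      | exact PEmpty.elim f
      | exact ((Category.id_comp (obj := D) _).trans (Category.comp_id (obj := D) _)).symm
  whiskerRight_comp := by
    intro a b c d f f' η g h
    cases a <;> cases b <;> cases c <;> cases d <;>
    first
      | rfl
      | exact PEmpty.elim f
      | exact PEmpty.elim g
      | exact PEmpty.elim h
      | exact ((Category.id_comp (obj := D) _).trans (Category.comp_id (obj := D) _)).symm
  whisker_assoc := by
    intro a b c d f g g' η h
    cases a <;> cases b <;> cases c <;> cases d <;>
    first
      | rfl
      | exact PEmpty.elim f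
      | exact PEmpty.elim g
      | exact PEmpty.elim h
      | exact ((Category.id_comp (obj := D) _).trans (Category.comp_id (obj := D) _)).symm
  whisker_exchange := by
    intro a b c f g h i η θ
    cases a <;> cases b <;> cases c <;>
    first
      | rfl
      | exact PEmpty.elim f
      | exact PEmpty.elim h
      | exact (Category.id_comp (obj := D) _).trans (Category.comp_id (obj := D) _).symm
      | exact (Category.comp_id (obj := D) _).trans (Category.id_comp (obj := D) _).symm
  pentagon := by
    intro a b c d e f g h i
    cases a <;> cases b <;> cases c <;> cases d <;> cases e <;>
    first
      | rfl
      | exact PEmpty.elim f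
      | exact PEmpty.elim g
      | exact PEmpty.elim h
      | exact PEmpty.elim i
      | exact (Category.id_comp (obj := D) _).trans (Category.id_comp (obj := D) _)
      | exact (Category.id_comp (obj := D) _)
  triangle := by
    intro a b c f g
    cases a <;> cases b <;> cases c <;>
    first
      | rfl
      | exact PEmpty.elim f
      | exact PEmpty.elim g
      | exact Category.id_comp (obj := D) _

instance strict : Bicategory.Strict (Suspension D) where
  id_comp := homId_comp
  comp_id := homComp_id
  assoc := homComp_assoc

end Suspension

/-! ### The simplicial set of matrices -/

/-- An `n`-simplex of `Mat D`: a functor `[k] × [l]ᵒᵖ ⥤ D` with `k, l ≥ -1` and `k + l = n - 1`.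
Here `rows = k + 1` and `cols = l + 1`, so that `[k]` is the poset `Fin rows` and `[l]` is the poset
`Fin cols`, with `[-1] = Fin 0` empty. -/
structure Mat (D : Type u) [Category.{v} D] (n : ℕ) where
  rows : ℕ
  cols : ℕ
  total : rows + cols = n + 1
  entries : Fin rows × (Fin cols)ᵒᵖ ⥤ D

namespace Mat

/-- The number of `i` in `[m]` that a monotone map sends to one of the first `a` elements. -/
def cut {m n : ℕ} (θ : Fin (m + 1) →o Fin (n + 1)) (a : ℕ) : ℕ :=
  (Finset.univ.filter fun i ↦ (θ i : ℕ) < a).card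

theorem cut_le {m n : ℕ} (θ : Fin (m + 1) →o Fin (n + 1)) (a : ℕ) : cut θ a ≤ m + 1 :=
  (Finset.card_filter_le _ _).trans (by simp)

theorem lt_cut_iff {m n : ℕ} (θ : Fin (m + 1) →o Fin (n + 1)) (a : ℕ) (i : Fin (m + 1)) :
    (i : ℕ) < cut θ a ↔ (θ i : ℕ) < a := by
  constructor
  · intro h
    by_contra! hi
    have hsub : (Finset.univ.filter fun j ↦ (θ j : ℕ) < a) ⊆ Finset.Iio i := by
      intro j hj
      rw [Finset.mem_filter] at hj
      rw [Finset.mem_Iio]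
      by_contra! hij
      have := θ.monotone hij
      rw [Fin.le_def] at this
      omega
    have := Finset.card_le_card hsub
    rw [Fin.card_Iio] at this
    rw [cut] at h
    omega
  · intro h
    have hsub : Finset.Iic i ⊆ (Finset.univ.filter fun j ↦ (θ j : ℕ) < a) := by
      intro j hj
      rw [Finset.mem_Iic] at hj
      rw [Finset.mem_filter]
      have := θ.monotone hj
      rw [Fin.le_def] at this
      exact ⟨Finset.mem_univ _, by omega⟩
    have := Finset.card_le_card hsub
    rw [Fin.card_Iic] at this
    rw [cut]
    omega

/-- The map `[k'] → [k]` obtained by restricting `θ : [m] → [n]` to the elements sent to the first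
`a = k + 1` elements. -/
def rowMap {m n a b a' b' : ℕ} (θ : Fin (m + 1) →o Fin (n + 1))
    (_ : a + b = n + 1) (h' : a' + b' = m + 1)
    (H : ∀ i : Fin (m + 1), (i : ℕ) < a' ↔ (θ i : ℕ) < a) : Fin a' →o Fin a where
  toFun i := ⟨θ ⟨i, by omega⟩, (H ⟨i, by omega⟩).1 i.2⟩
  monotone' _ _ hij := θ.monotone hij

/-- The map `[l'] → [l]` obtained by restricting `θ : [m] → [n]` to the elements sent to the last
`b = l + 1` elements. -/
def colMap {m n a b a' b' : ℕ} (θ : Fin (m + 1) →o Fin (n + 1))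
    (h : a + b = n + 1) (h' : a' + b' = m + 1)
    (_ : ∀ i : Fin (m + 1), (i : ℕ) < a' ↔ (θ i : ℕ) < a) : Fin b' →o Fin b where
  toFun j := ⟨θ ⟨a' + j, by omega⟩ - a, by
    have := (θ ⟨a' + j, by omega⟩).2
    have := j.2
    by_cases hb : b = 0
    · have := (‹∀ i : Fin (m + 1), (i : ℕ) < a' ↔ (θ i : ℕ) < a› ⟨a' + j, by omega⟩).2 (by omega)
      simp only at this
      omega
    · omega⟩
  monotone' i j hij := Nat.sub_le_sub_right
    (θ.monotone (a := ⟨a' + i, by omega⟩) (b := ⟨a' + j, by omega⟩)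
      (by rw [Fin.le_def] at hij ⊢; simpa using hij)) a

variable {D : Type u} [Category.{v} D]

/-- The matrix `(f × gᵒᵖ) ⋙ M`, for monotone maps `f` between the rows and `g` between the
columns. -/
def pull {a b a' b' : ℕ} (M : Fin a × (Fin b)ᵒᵖ ⥤ D) (f : Fin a' →o Fin a) (g : Fin b' →o Fin b) :
    Fin a' × (Fin b')ᵒᵖ ⥤ D :=
  (f.monotone.functor.prod g.monotone.functor.op) ⋙ M

/-- The action of a monotone map `θ : [m] → [n]` on a matrix: writing `[n]` as the ordered disjoint
union of the set of rows and the set of columns of the matrix, restrict `θ` to the preimages of these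
two sets, and precompose the matrix with the two restrictions. -/
def reindex {m n : ℕ} (M : Mat D n) (θ : Fin (m + 1) →o Fin (n + 1)) : Mat D m where
  rows := cut θ M.rows
  cols := m + 1 - cut θ M.rows
  total := Nat.add_sub_cancel' (cut_le θ M.rows)
  entries := pull M.entries
    (rowMap θ M.total (Nat.add_sub_cancel' (cut_le θ M.rows)) (lt_cut_iff θ M.rows))
    (colMap θ M.total (Nat.add_sub_cancel' (cut_le θ M.rows)) (lt_cut_iff θ M.rows))

theorem reindex_mk {m n a b a' b' : ℕ} (h : a + b = n + 1) (M : Fin a × (Fin b)ᵒᵖ ⥤ D)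
    (θ : Fin (m + 1) →o Fin (n + 1)) (h' : a' + b' = m + 1)
    (H : ∀ i : Fin (m + 1), (i : ℕ) < a' ↔ (θ i : ℕ) < a) :
    (mk a b h M).reindex θ = ⟨a', b', h', pull M (rowMap θ h h' H) (colMap θ h h' H)⟩ := by
  obtain rfl : a' = cut θ a := by
    have hle := cut_le θ a
    apply le_antisymm
    · by_contra! hlt
      have h1 := (H ⟨cut θ a, by omega⟩).1 hlt
      exact lt_irrefl _ ((lt_cut_iff θ a ⟨cut θ a, by omega⟩).2 h1)
    · by_contra! hlt
      have h1 := (lt_cut_iff θ a ⟨a', by omega⟩).1 hlt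
      exact lt_irrefl _ ((H ⟨a', by omega⟩).2 h1)
  obtain rfl : b' = m + 1 - cut θ a := by omega
  rfl

theorem reindex_mk_eq {m n a b a' b' : ℕ} (h : a + b = n + 1) (M : Fin a × (Fin b)ᵒᵖ ⥤ D)
    (θ : Fin (m + 1) →o Fin (n + 1)) (h' : a' + b' = m + 1)
    (f : Fin a' →o Fin a) (g : Fin b' →o Fin b)
    (hf : ∀ i : Fin a', (θ ⟨i, by omega⟩ : ℕ) = f i)
    (hg : ∀ j : Fin b', (θ ⟨a' + j, by omega⟩ : ℕ) = a + g j) :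
    (mk a b h M).reindex θ = ⟨a', b', h', pull M f g⟩ := by
  have H : ∀ i : Fin (m + 1), (i : ℕ) < a' ↔ (θ i : ℕ) < a := by
    intro i
    by_cases hi : (i : ℕ) < a'
    · have h1 := hf ⟨i, hi⟩
      have h2 := (f ⟨i, hi⟩).2
      simp only [Fin.eta] at h1
      omega
    · have h1 := hg ⟨i - a', by omega⟩
      have h2 : (⟨a' + (i - a'), by omega⟩ : Fin (m + 1)) = i := by
        ext
        simp only
        omega
      simp only [h2] at h1
      omega
  obtain rfl : rowMap θ h h' H = f := by
    ext i
    exact hf i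
  obtain rfl : colMap θ h h' H = g := by
    ext j
    have := hg j
    change (θ _ : ℕ) - a = g j
    omega
  exact reindex_mk h M θ h' H

theorem reindex_id {n : ℕ} (M : Mat D n) : M.reindex OrderHom.id = M := by
  obtain ⟨a, b, h, M⟩ := M
  rw [reindex_mk h M OrderHom.id h (fun i ↦ Iff.rfl)]
  have hc : colMap OrderHom.id h h (fun _ ↦ Iff.rfl) = OrderHom.id := by
    ext j
    simp [colMap]
  rw [hc]
  rfl

theorem reindex_comp {m n p : ℕ} (M : Mat D p) (η : Fin (n + 1) →o Fin (p + 1))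
    (θ : Fin (m + 1) →o Fin (n + 1)) :
    M.reindex (η.comp θ) = (M.reindex η).reindex θ := by
  obtain ⟨a, b, h, M⟩ := M
  have h1 := Nat.add_sub_cancel' (cut_le η a)
  have h2 := Nat.add_sub_cancel' (cut_le θ (cut η a))
  have H1 := lt_cut_iff η a
  have H2 := lt_cut_iff θ (cut η a)
  have H3 : ∀ i : Fin (m + 1), (i : ℕ) < cut θ (cut η a) ↔ (η.comp θ i : ℕ) < a :=
    fun i ↦ (H2 i).trans (H1 (θ i))
  rw [reindex_mk h M (η.comp θ) h2 H3, reindex_mk h M η h1 H1, reindex_mk h1 _ θ h2 H2]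
  have hc : colMap (η.comp θ) h h2 H3 = (colMap η h h1 H1).comp (colMap θ h1 h2 H2) := by
    ext j
    have hj := (H2 ⟨cut θ (cut η a) + j, by omega⟩).not
    simp only [not_lt, Nat.le_add_right, true_iff] at hj
    change ((η (θ _) : ℕ)) - a = (η _ : ℕ) - a
    congr 3
    ext
    change (θ _ : ℕ) = cut η a + ((θ _ : ℕ) - cut η a)
    omega
  rw [hc]
  rfl

variable (D) in
/-- The simplicial set `Mat D` of `D`-valued matrices. -/
def sSet : SSet.{max u v} where
  obj n := Mat D n.unop.len
  map θ := TypeCat.ofHom fun M ↦ M.reindex θ.unop.toOrderHom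
  map_id n := by
    ext M
    exact reindex_id M
  map_comp f g := by
    ext M
    exact reindex_comp M f.unop.toOrderHom g.unop.toOrderHom

/-- Deleting a row: `dᵢ M = (dⁱ × id) ⋙ M` for `0 ≤ i ≤ k`, where `k = a`. -/
theorem face_row {n a b : ℕ} (h : (a + 1) + b = (n + 1) + 1) (M : Fin (a + 1) × (Fin b)ᵒᵖ ⥤ D)
    (i : Fin (a + 1)) :
    (sSet D).δ (n := n) ⟨i, by omega⟩ (⟨a + 1, b, h, M⟩ : Mat D (n + 1)) =
      (⟨a, b, by omega, pull M (Fin.succAboveOrderEmb i).toOrderHom OrderHom.id⟩ : Mat D n) := by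
  refine reindex_mk_eq h M _ _ _ _ (fun i' ↦ ?_) (fun j' ↦ ?_)
  · have := i.2
    simp [SimplexCategory.δ, Fin.succAbove, Fin.lt_def]
    split_ifs <;> simp <;> omega
  · have := i.2
    simp [SimplexCategory.δ, Fin.succAbove, Fin.lt_def]
    split_ifs <;> simp <;> omega

/-- Deleting a column: `dᵢ M = (id × dʲ) ⋙ M` for `i = (k + 1) + j`, where `k + 1 = a`. -/
theorem face_col {n a b : ℕ} (h : a + (b + 1) = (n + 1) + 1) (M : Fin a × (Fin (b + 1))ᵒᵖ ⥤ D)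
    (j : Fin (b + 1)) :
    (sSet D).δ (n := n) ⟨a + j, by omega⟩ (⟨a, b + 1, h, M⟩ : Mat D (n + 1)) =
      (⟨a, b, by omega, pull M OrderHom.id (Fin.succAboveOrderEmb j).toOrderHom⟩ : Mat D n) := by
  refine reindex_mk_eq h M _ _ _ _ (fun i' ↦ ?_) (fun j' ↦ ?_)
  · have := j.2
    simp [SimplexCategory.δ, Fin.succAbove, Fin.lt_def]
    split_ifs <;> simp <;> omega
  · have := j.2
    simp [SimplexCategory.δ, Fin.succAbove, Fin.lt_def]
    split_ifs <;> simp <;> omega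

/-- Doubling a row: `sᵢ M = (sⁱ × id) ⋙ M` for `0 ≤ i ≤ k`, where `k = a`. -/
theorem degeneracy_row {n a b : ℕ} (h : (a + 1) + b = n + 1) (M : Fin (a + 1) × (Fin b)ᵒᵖ ⥤ D)
    (i : Fin (a + 1)) :
    (sSet D).σ (n := n) ⟨i, by omega⟩ (⟨a + 1, b, h, M⟩ : Mat D n) =
      (⟨a + 2, b, by omega, pull M (Fin.predAboveOrderHom i) OrderHom.id⟩ : Mat D (n + 1)) := by
  refine reindex_mk_eq h M _ _ _ _ (fun i' ↦ ?_) (fun j' ↦ ?_)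
  · have := i.2
    simp [SimplexCategory.σ, Fin.predAbove, Fin.lt_def]
    split_ifs <;> simp <;> omega
  · have := i.2
    simp [SimplexCategory.σ, Fin.predAbove, Fin.lt_def]
    split_ifs <;> simp <;> omega

/-- Doubling a column: `sᵢ M = (id × sʲ) ⋙ M` for `i = (k + 1) + j`, where `k + 1 = a`. -/
theorem degeneracy_col {n a b : ℕ} (h : a + (b + 1) = n + 1) (M : Fin a × (Fin (b + 1))ᵒᵖ ⥤ D)
    (j : Fin (b + 1)) :
    (sSet D).σ (n := n) ⟨a + j, by omega⟩ (⟨a, b + 1, h, M⟩ : Mat D n) =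
      (⟨a, b + 2, by omega, pull M OrderHom.id (Fin.predAboveOrderHom j)⟩ : Mat D (n + 1)) := by
  refine reindex_mk_eq h M _ _ _ _ (fun i' ↦ ?_) (fun j' ↦ ?_)
  · have := j.2
    simp [SimplexCategory.σ, Fin.predAbove, Fin.lt_def]
    split_ifs <;> simp <;> omega
  · have := j.2
    simp [SimplexCategory.σ, Fin.predAbove, Fin.lt_def]
    split_ifs <;> simp <;> omega

variable (D) in
/-- The map `q : Mat D ⟶ Δ[1]` that sends `[k] × [l]ᵒᵖ ⥤ D` to the simplex `χₖ : [n] → [1]`, which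
takes the value `0` exactly on the `i ≤ k`, that is, on the `i < rows`. -/
def toInterval : sSet D ⟶ SSet.stdSimplex.{max u v}.obj (SimplexCategory.mk 1) where
  app n := TypeCat.ofHom fun (M : Mat D n.unop.len) ↦
    SSet.stdSimplex.objEquiv.symm (SimplexCategory.Hom.mk
      { toFun := fun i ↦ if (i : ℕ) < M.rows then 0 else 1
        monotone' := by
          intro i j hij
          rw [Fin.le_def] at hij
          dsimp only
          split_ifs
          · exact le_rfl
          · exact Fin.zero_le _
          · omega
          · exact le_rfl })
  naturality n m f := by
    ext M
    apply SSet.stdSimplex.objEquiv.injective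
    ext i
    exact congrArg (fun (z : Fin 2) ↦ (z : ℕ))
      (if_congr (lt_cut_iff f.unop.toOrderHom M.rows i) rfl rfl)

end Mat

/-! ### The map to the interval and the type of a simplex -/

namespace Suspension

variable {D : Type u}

/-- The vertex of `[1]` to which the canonical functor `ΣD → [1]` sends an object of `ΣD`. -/
def vertex : Suspension D → Fin 2
  | x => 0
  | y => 1

theorem vertex_le [Category.{v} D] : ∀ {a b : Suspension D}, (a ⟶ b) → vertex a ≤ vertex b
  | x, _, _ => Fin.zero_le _
  | y, y, _ => le_rfl
  | y, x, f => PEmpty.elim f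

variable (D) [Category.{v} D]

/-- The map `p : N(ΣD) ⟶ Δ[1]` induced by the canonical functor `ΣD → [1]`. -/
def toInterval :
    duskinNerve (Suspension D) ⟶ SSet.stdSimplex.{max u v}.obj (SimplexCategory.mk 1) where
  app n := TypeCat.ofHom fun (s : Simplex (Suspension D) n.unop.len) ↦
    SSet.stdSimplex.objEquiv.symm (SimplexCategory.Hom.mk
      { toFun := fun i ↦ vertex (s.obj i)
        monotone' := fun i j hij ↦ vertex_le (s.map i j hij) })
  naturality _ _ _ := rfl

variable {D}

/-- The `n`-simplex of `N(ΣD)` is maximally degenerate at the object `a`: it is the degeneracy of the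
`0`-simplex `a`. -/
def IsConstantAt {n : ℕ} (s : (duskinNerve (Suspension D)).obj (op (SimplexCategory.mk n)))
    (a : Suspension D) : Prop :=
  ∃ s₀ : (duskinNerve (Suspension D)).obj (op (SimplexCategory.mk 0)),
    Simplex.obj s₀ 0 = a ∧
    s = (duskinNerve (Suspension D)).map
      (SimplexCategory.const (SimplexCategory.mk n) (SimplexCategory.mk 0) 0).op s₀

/-- The `n`-simplex of `N(ΣD)` is of type `k`, for `-1 ≤ k ≤ n`. For `0 ≤ k ≤ n - 1` this says that
its edge `(k, k + 1)` is non-degenerate. The simplices of type `-1` and of type `n` are the simplices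
that are maximally degenerate at `y` and at `x`, respectively. -/
def IsOfType {n : ℕ} (s : (duskinNerve (Suspension D)).obj (op (SimplexCategory.mk n)))
    (k : ℤ) : Prop :=
  (k = -1 ∧ IsConstantAt s y) ∨
  (∃ i : Fin n, k = (i : ℕ) ∧
    (duskinNerve (Suspension D)).map (SimplexCategory.mkOfSucc i).op s ∈
      (duskinNerve (Suspension D)).nonDegenerate 1) ∨
  (k = n ∧ IsConstantAt s x)

end Suspension

end DuskinNerve

/-!
The vertices of an `n`-simplex of `N(ΣD)` are `x, …, x, y, …, y`, since there is no `1`-morphism from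
`y` to `x`. Call the positions `i` of the vertices `x` rows and the positions `j` of the vertices `y`
columns. All data of the simplex outside `Hom(x, y) = D` are unique. What remains is an object `M i j`
of `D` for each row `i` and column `j` (the edge from `i` to `j`), a morphism `M i j ⟶ M i' j` for rows
`i ≤ i'` (the triangle `i, i', j`) and a morphism `M i j ⟶ M i j'` for columns `j' ≤ j` (the triangle
`i, j', j`). Normality says that these morphisms are identities for `i = i'` and `j = j'`, and the
tetrahedron relation says, for vertices `x, x, x, y`, that the morphisms along a column compose, for
`x, y, y, y`, that those along a row compose, and, for `x, x, y, y`, that the two kinds commute. This is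
a functor from the product of the poset of rows and the opposite of the poset of columns to `D`.

This correspondence is `toSimplex`, with inverse `toFunctor` (`toFunctor_toSimplex` and
`toSimplex_toFunctor`). Rows and columns are subtypes of `[n]` there, so that its compatibility with
reindexing (`toSimplex_reindex`) holds by definition. Numbering the rows and the columns consecutively
turns such a functor into a matrix; this gives the bijective natural map `matToNerve`. A simplex is of
type `k` exactly if its first `k + 1` vertices are `x` and the others are `y` (`isOfType_iff`), because
an edge is non-degenerate exactly if it goes from `x` to `y`.
-/

namespace DuskinNerve

namespace Suspension

/-! ### Morphisms of the suspension with variable endpoints -/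

section Morphisms

variable {D : Type u}

theorem eq_x_or_eq_y (p : Suspension D) : p = x ∨ p = y := by
  cases p <;> simp

theorem ne_x_iff {p : Suspension D} : p ≠ x ↔ p = y := by
  cases p <;> simp

theorem not_vertex_le : ¬vertex (y : Suspension D) ≤ vertex (x : Suspension D) := by
  change ¬(1 : Fin 2) ≤ 0
  decide

variable [Category.{v} D]

/-- The object of `D` that a `1`-morphism from `x` to `y` is. The endpoints are variables, equal to
`x` and `y` by hypothesis, because the vertices of a simplex are only propositionally `x` or `y`. -/
def entry : ∀ {p q : Suspension D}, (p ⟶ q) → p = x → q = y → D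
  | x, y, d, _, _ => d

/-- The `1`-morphism `p ⟶ q` that is the object `e` of `D` if `p = x` and `q = y`, and is the
identity if `p = q`. -/
def ofEntry : ∀ (p q : Suspension D), vertex p ≤ vertex q → (p = x → q = y → D) → (p ⟶ q)
  | x, y, _, e => e rfl rfl
  | x, x, _, _ => PUnit.unit
  | y, y, _, _ => PUnit.unit
  | y, x, h, _ => absurd h not_vertex_le

theorem entry_ofEntry {p q : Suspension D} (h : vertex p ≤ vertex q) (e : p = x → q = y → D)
    (hp : p = x) (hq : q = y) : entry (ofEntry p q h e) hp hq = e hp hq := by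
  subst hp hq
  rfl

theorem ofEntry_entry {p q : Suspension D} (h : vertex p ≤ vertex q) (f : p ⟶ q) :
    ofEntry p q h (entry f) = f := by
  cases p <;> cases q <;> first | rfl | exact PEmpty.elim f

/-- A `2`-cell `f ⟶ g ≫ h` over objects `x, x, y` is a morphism `f ⟶ h` in `D`. -/
def rowCell : ∀ {p q r : Suspension D} {f : p ⟶ r} {g : p ⟶ q} {h : q ⟶ r} (_ : f ⟶ g ≫ h)
    (hp : p = x) (hq : q = x) (hr : r = y), entry f hp hr ⟶ entry h hq hr
  | x, x, y, _, _, _, η, _, _, _ => η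

/-- A `2`-cell `f ⟶ g ≫ h` over objects `x, y, y` is a morphism `f ⟶ g` in `D`. -/
def colCell : ∀ {p q r : Suspension D} {f : p ⟶ r} {g : p ⟶ q} {h : q ⟶ r} (_ : f ⟶ g ≫ h)
    (hp : p = x) (hq : q = y) (hr : r = y), entry f hp hr ⟶ entry g hp hq
  | x, y, y, _, _, _, η, _, _, _ => η

/-- The `2`-cell of a triangle with vertices `p, q, r` whose edges are given by entries: it is a
morphism between entries in the same column if the vertices are `x, x, y`, a morphism between entries
in the same row if they are `x, y, y`, and trivial otherwise. -/
def ofCells : ∀ (p q r : Suspension D) (hpq : vertex p ≤ vertex q) (hqr : vertex q ≤ vertex r)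
    {f : p = x → r = y → D} {g : p = x → q = y → D} {h : q = x → r = y → D}
    (_ : ∀ hp hq hr, f hp hr ⟶ h hq hr) (_ : ∀ hp hq hr, f hp hr ⟶ g hp hq),
    (ofEntry p r (hpq.trans hqr) f) ⟶
      (ofEntry p q hpq g) ≫ (ofEntry q r hqr h)
  | x, x, y, _, _, _, _, _, R, _ => R rfl rfl rfl
  | x, y, y, _, _, _, _, _, _, C => C rfl rfl rfl
  | x, x, x, _, _, _, _, _, _, _ => PUnit.unit
  | y, y, y, _, _, _, _, _, _, _ => PUnit.unit
  | y, x, _, h, _, _, _, _, _, _ => absurd h not_vertex_le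
  | _, y, x, _, h, _, _, _, _, _ => absurd h not_vertex_le

theorem rowCell_ofCells {p q r : Suspension D} (hpq : vertex p ≤ vertex q)
    (hqr : vertex q ≤ vertex r) {f : p = x → r = y → D} {g : p = x → q = y → D}
    {h : q = x → r = y → D} (R : ∀ hp hq hr, f hp hr ⟶ h hq hr) (C : ∀ hp hq hr, f hp hr ⟶ g hp hq)
    (hp : p = x) (hq : q = x) (hr : r = y) :
    rowCell (ofCells p q r hpq hqr R C) hp hq hr =
      eqToHom (entry_ofEntry _ f hp hr) ≫ R hp hq hr ≫
        eqToHom (entry_ofEntry hqr h hq hr).symm := by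
  subst hp hq hr
  exact ((Category.id_comp _).trans (Category.comp_id _)).symm

theorem colCell_ofCells {p q r : Suspension D} (hpq : vertex p ≤ vertex q)
    (hqr : vertex q ≤ vertex r) {f : p = x → r = y → D} {g : p = x → q = y → D}
    {h : q = x → r = y → D} (R : ∀ hp hq hr, f hp hr ⟶ h hq hr) (C : ∀ hp hq hr, f hp hr ⟶ g hp hq)
    (hp : p = x) (hq : q = y) (hr : r = y) :
    colCell (ofCells p q r hpq hqr R C) hp hq hr =
      eqToHom (entry_ofEntry _ f hp hr) ≫ C hp hq hr ≫
        eqToHom (entry_ofEntry hpq g hp hq).symm := by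
  subst hp hq hr
  exact ((Category.id_comp _).trans (Category.comp_id _)).symm

theorem ofCells_rowCell_colCell {p q r : Suspension D} (hpq : vertex p ≤ vertex q)
    (hqr : vertex q ≤ vertex r) {f : p ⟶ r} {g : p ⟶ q} {h : q ⟶ r} (η : f ⟶ g ≫ h)
    (e : (ofEntry p q hpq (entry g)) ≫ (ofEntry q r hqr (entry h)) =
      g ≫ h) :
    ofCells p q r hpq hqr (rowCell η) (colCell η) ≫ eqToHom e =
      eqToHom (ofEntry_entry (hpq.trans hqr) f) ≫ η := by
  cases p <;> cases q <;> cases r <;>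
  first
    | rfl
    | exact PEmpty.elim f
    | exact PEmpty.elim g
    | exact PEmpty.elim h
    | exact (Category.comp_id (obj := D) _).trans (Category.id_comp (obj := D) _).symm

open Bicategory

theorem ofEntry_self (p : Suspension D) (h : vertex p ≤ vertex p) (e : p = x → p = y → D) :
    ofEntry p p h e = 𝟙 p := by
  cases p <;> rfl

theorem ofCells_left {p q : Suspension D} (h : vertex p ≤ vertex q)
    {e : p = x → q = y → D} {u : p = x → p = y → D}
    (R : ∀ (hp : p = x) (_ : p = x) hq, e hp hq ⟶ e hp hq)
    (C : ∀ (hp : p = x) (hp' : p = y) (hq : q = y), e hp hq ⟶ u hp hp')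
    (hR : ∀ hp hq, R hp hp hq = 𝟙 _) (e₀ : ofEntry p p le_rfl u = 𝟙 p) :
    ofCells p p q le_rfl h R C ≫ eqToHom e₀ ▷ (ofEntry p q h e) ≫ (λ_ _).hom =
      𝟙 _ := by
  cases p <;> cases q
  · rfl
  · exact (congrArg (R rfl rfl rfl ≫ ·) (Category.comp_id (obj := D) _)).trans
      ((Category.comp_id (obj := D) _).trans (hR rfl rfl))
  · exact absurd h not_vertex_le
  · rfl

theorem ofCells_right {p q : Suspension D} (h : vertex p ≤ vertex q)
    {e : p = x → q = y → D} {u : q = x → q = y → D}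
    (R : ∀ (hp : p = x) (hq : q = x) (hq' : q = y), e hp hq' ⟶ u hq hq')
    (C : ∀ (hp : p = x) (hq : q = y) (_ : q = y), e hp hq ⟶ e hp hq)
    (hC : ∀ hp hq, C hp hq hq = 𝟙 _) (e₀ : ofEntry q q le_rfl u = 𝟙 q) :
    ofCells p q q h le_rfl R C ≫ (ofEntry p q h e) ◁ eqToHom e₀ ≫ (ρ_ _).hom =
      𝟙 _ := by
  cases p <;> cases q
  · rfl
  · exact (congrArg (C rfl rfl rfl ≫ ·) (Category.comp_id (obj := D) _)).trans
      ((Category.comp_id (obj := D) _).trans (hC rfl rfl))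
  · exact absurd h not_vertex_le
  · rfl

/-- If the cells of the faces of a tetrahedron are given by morphisms in `D`, the tetrahedron relation
is functoriality along the columns (`hR`), functoriality along the rows (`hC`), or commutation of the
two directions (`hRC`), depending on how many vertices are `x`. -/
theorem ofCells_tetrahedron {p q r s : Suspension D} (hpq : vertex p ≤ vertex q)
    (hqr : vertex q ≤ vertex r) (hrs : vertex r ≤ vertex s)
    {pq : p = x → q = y → D} {pr : p = x → r = y → D} {ps : p = x → s = y → D}
    {qr : q = x → r = y → D} {qs : q = x → s = y → D} {rs : r = x → s = y → D}
    (Rpqr : ∀ hp hq hr, pr hp hr ⟶ qr hq hr) (Cpqr : ∀ hp hq hr, pr hp hr ⟶ pq hp hq)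
    (Rpqs : ∀ hp hq hs, ps hp hs ⟶ qs hq hs) (Cpqs : ∀ hp hq hs, ps hp hs ⟶ pq hp hq)
    (Rprs : ∀ hp hr hs, ps hp hs ⟶ rs hr hs) (Cprs : ∀ hp hr hs, ps hp hs ⟶ pr hp hr)
    (Rqrs : ∀ hq hr hs, qs hq hs ⟶ rs hr hs) (Cqrs : ∀ hq hr hs, qs hq hs ⟶ qr hq hr)
    (hR : ∀ hp hq hr hs, Rprs hp hr hs = Rpqs hp hq hs ≫ Rqrs hq hr hs)
    (hRC : ∀ hp hq hr hs, Cprs hp hr hs ≫ Rpqr hp hq hr = Rpqs hp hq hs ≫ Cqrs hq hr hs)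
    (hC : ∀ hp hq hr hs, Cprs hp hr hs ≫ Cpqr hp hq hr = Cpqs hp hq hs) :
    ofCells p r s (hpq.trans hqr) hrs Rprs Cprs ≫
        ofCells p q r hpq hqr Rpqr Cpqr ▷ (ofEntry r s hrs rs) ≫ (α_ _ _ _).hom =
      ofCells p q s hpq (hqr.trans hrs) Rpqs Cpqs ≫
        (ofEntry p q hpq pq) ◁ ofCells q r s hqr hrs Rqrs Cqrs := by
  rcases p with _ | _ <;> rcases q with _ | _ <;> rcases r with _ | _ <;> rcases s with _ | _ <;>
  first
    | exact absurd hpq not_vertex_le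
    | exact absurd hqr not_vertex_le
    | exact absurd hrs not_vertex_le
    | rfl
    | exact ((congrArg (Rprs rfl rfl rfl ≫ ·) (Category.comp_id (obj := D) _)).trans
        (Category.comp_id (obj := D) _)).trans (hR rfl rfl rfl rfl)
    | exact (congrArg (Cprs rfl rfl rfl ≫ ·) (Category.comp_id (obj := D) _)).trans
        (hRC rfl rfl rfl rfl)
    | exact (congrArg (Cprs rfl rfl rfl ≫ ·) (Category.comp_id (obj := D) _)).trans
        ((hC rfl rfl rfl rfl).trans (Category.comp_id (obj := D) _).symm)

end Morphisms

/-! ### Simplices with prescribed vertices as functors -/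

section Functors

variable {D : Type u} [Category.{v} D]

open Bicategory

/-- The functor `(f × gᵒᵖ) ⋙ F`, for monotone maps `f` and `g`. -/
abbrev restrict {α β α' β' : Type*} [Preorder α] [Preorder β] [Preorder α'] [Preorder β']
    (F : α × βᵒᵖ ⥤ D) (f : α' →o α) (g : β' →o β) : α' × β'ᵒᵖ ⥤ D :=
  (f.monotone.functor.prod g.monotone.functor.op) ⋙ F

variable {n : ℕ}

/-- The rows of a simplex with vertices `o`. -/
abbrev Rows (o : Fin (n + 1) → Suspension D) : Type := {i // o i = x}

/-- The columns of a simplex with vertices `o`. -/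
abbrev Cols (o : Fin (n + 1) → Suspension D) : Type := {j // o j = y}

/-- The morphism from position `(i, j)` to position `(i', j')`, for `i ≤ i'` and `j' ≤ j`. -/
def step {α β : Type*} [Preorder α] [Preorder β] {i i' : α} {j j' : β} (hi : i ≤ i') (hj : j' ≤ j) :
    ((i, op j) : α × βᵒᵖ) ⟶ (i', op j') :=
  (homOfLE hi, (homOfLE hj).op)

/-- The simplex of `N(ΣD)` with vertices `o` whose edges from `x` to `y` are the values of `F` on
objects and whose `2`-cells are the values of `F` on steps along a column or along a row. -/
def toSimplex (o : Fin (n + 1) → Suspension D) (ho : ∀ i j, i ≤ j → vertex (o i) ≤ vertex (o j))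
    (F : Rows o × (Cols o)ᵒᵖ ⥤ D) : Simplex (Suspension D) n where
  obj := o
  map i j h := ofEntry (o i) (o j) (ho i j h) fun hi hj ↦ F.obj (⟨i, hi⟩, op ⟨j, hj⟩)
  cell i j k hij hjk := ofCells (o i) (o j) (o k) (ho i j hij) (ho j k hjk)
    (fun _ _ _ ↦ F.map (step hij le_rfl)) (fun _ _ _ ↦ F.map (step le_rfl hjk))
  map_self _ := ofEntry_self _ _ _
  cell_left _ _ _ := ofCells_left _ _ _ (fun _ _ ↦ F.map_id _) _
  cell_right _ _ _ := ofCells_right _ _ _ (fun _ _ ↦ F.map_id _) _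
  tetrahedron _ _ _ _ hij hjk hkl := ofCells_tetrahedron _ _ _ _ _ _ _ _ _ _ _
    (fun _ _ _ _ ↦ F.map_comp (step hij le_rfl) (step hjk le_rfl))
    (fun _ _ _ _ ↦ (F.map_comp (step le_rfl hkl) (step hij le_rfl)).symm.trans
      (F.map_comp (step hij le_rfl) (step le_rfl hkl)))
    (fun _ _ _ _ ↦ (F.map_comp (step le_rfl hkl) (step le_rfl hjk)).symm)

theorem rowCell_left {p q : Suspension D} {u : p ⟶ p} {f : p ⟶ q} (η : f ⟶ u ≫ f) (hu : u = 𝟙 p)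
    (H : η ≫ eqToHom hu ▷ f ≫ (λ_ f).hom = 𝟙 f) (hp : p = x) (hq : q = y) :
    rowCell η hp hp hq = 𝟙 _ := by
  subst hp hq
  exact ((congrArg (rowCell η rfl rfl rfl ≫ ·) (Category.comp_id (obj := D) _)).trans
    (Category.comp_id (obj := D) _)).symm.trans H

theorem colCell_right {p q : Suspension D} {u : q ⟶ q} {f : p ⟶ q} (η : f ⟶ f ≫ u) (hu : u = 𝟙 q)
    (H : η ≫ f ◁ eqToHom hu ≫ (ρ_ f).hom = 𝟙 f) (hp : p = x) (hq : q = y) :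
    colCell η hp hq hq = 𝟙 _ := by
  subst hp hq
  exact ((congrArg (colCell η rfl rfl rfl ≫ ·) (Category.comp_id (obj := D) _)).trans
    (Category.comp_id (obj := D) _)).symm.trans H

section

variable {p q r s : Suspension D} {pq : p ⟶ q} {pr : p ⟶ r} {ps : p ⟶ s} {qr : q ⟶ r} {qs : q ⟶ s}
  {rs : r ⟶ s} (pqr : pr ⟶ pq ≫ qr) (pqs : ps ⟶ pq ≫ qs) (prs : ps ⟶ pr ≫ rs) (qrs : qs ⟶ qr ≫ rs)
  (H : prs ≫ pqr ▷ rs ≫ (α_ pq qr rs).hom = pqs ≫ pq ◁ qrs)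

include H

/-- The tetrahedron relation over vertices `x, x, x, y`: steps along a column compose. -/
theorem rowCell_comp (hp : p = x) (hq : q = x) (hr : r = x) (hs : s = y) :
    rowCell pqs hp hq hs ≫ rowCell qrs hq hr hs = rowCell prs hp hr hs := by
  subst hp hq hr hs
  exact H.symm.trans ((congrArg (rowCell prs rfl rfl rfl ≫ ·) (Category.comp_id (obj := D) _)).trans
    (Category.comp_id (obj := D) _))

/-- The tetrahedron relation over vertices `x, x, y, y`: steps along a column commute with steps along
a row. -/
theorem colCell_comp_rowCell (hp : p = x) (hq : q = x) (hr : r = y) (hs : s = y) :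
    colCell prs hp hr hs ≫ rowCell pqr hp hq hr = rowCell pqs hp hq hs ≫ colCell qrs hq hr hs := by
  subst hp hq hr hs
  exact (congrArg (colCell prs rfl rfl rfl ≫ ·) (Category.comp_id (obj := D) _)).symm.trans H

/-- The tetrahedron relation over vertices `x, y, y, y`: steps along a row compose. -/
theorem colCell_comp (hp : p = x) (hq : q = y) (hr : r = y) (hs : s = y) :
    colCell prs hp hr hs ≫ colCell pqr hp hq hr = colCell pqs hp hq hs := by
  subst hp hq hr hs
  exact (congrArg (colCell prs rfl rfl rfl ≫ ·) (Category.comp_id (obj := D) _)).symm.trans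
    (H.trans (Category.comp_id (obj := D) _))

end

/-- No edge goes from `y` to `x`, so the vertices equal to `x` precede those equal to `y`. -/
theorem le_of_map (s : Simplex (Suspension D) n) {i j : Fin (n + 1)} (hi : s.obj i = x)
    (hj : s.obj j = y) : i ≤ j := by
  by_contra! h
  have := vertex_le (s.map j i h.le)
  rw [hi, hj] at this
  exact not_vertex_le this

/-- The functor whose values on objects are the edges of a simplex of `N(ΣD)` from `x` to `y`, and
whose values on steps along a column or along a row are its `2`-cells. A general
morphism is factored as a step along a column followed by one along a row. -/
def toFunctor (s : Simplex (Suspension D) n) : Rows s.obj × (Cols s.obj)ᵒᵖ ⥤ D where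
  obj z := entry (s.map z.1 z.2.unop (le_of_map s z.1.2 z.2.unop.2)) z.1.2 z.2.unop.2
  map {z w} f :=
    rowCell (s.cell z.1 w.1 z.2.unop (leOfHom f.1) (le_of_map s w.1.2 z.2.unop.2)) z.1.2 w.1.2
        z.2.unop.2 ≫
      colCell (s.cell w.1 w.2.unop z.2.unop (le_of_map s w.1.2 w.2.unop.2) (leOfHom f.2.unop)) w.1.2
        w.2.unop.2 z.2.unop.2
  map_id z := by
    rw [rowCell_left _ (s.map_self _) (s.cell_left _ _ _),
      colCell_right _ (s.map_self _) (s.cell_right _ _ _), Category.comp_id]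
  map_comp {z w t} f g := by
    have hzt := leOfHom g.2.unop
    have hzw := leOfHom f.2.unop
    rw [← rowCell_comp _ _ _ _ (s.tetrahedron z.1 w.1 t.1 z.2.unop (leOfHom f.1) (leOfHom g.1)
        (le_of_map s t.1.2 z.2.unop.2)) z.1.2 w.1.2 t.1.2 z.2.unop.2,
      ← colCell_comp _ _ _ _ (s.tetrahedron t.1 t.2.unop w.2.unop z.2.unop
        (le_of_map s t.1.2 t.2.unop.2) hzt hzw) t.1.2 t.2.unop.2 w.2.unop.2 z.2.unop.2,
      Category.assoc, Category.assoc]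
    congr 1
    -- It remains to exchange the row step of `f` with the column step of `g`.
    rw [← Category.assoc, ← Category.assoc, colCell_comp_rowCell _ _ _ _ (s.tetrahedron w.1 t.1
      w.2.unop z.2.unop (leOfHom g.1) (le_of_map s t.1.2 w.2.unop.2) hzw) w.1.2 t.1.2 w.2.unop.2
      z.2.unop.2]

theorem toFunctor_toSimplex (o : Fin (n + 1) → Suspension D)
    (ho : ∀ i j, i ≤ j → vertex (o i) ≤ vertex (o j)) (F : Rows o × (Cols o)ᵒᵖ ⥤ D) :
    toFunctor (toSimplex o ho F) = F := by
  refine CategoryTheory.Functor.ext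
    (fun z : Rows o × (Cols o)ᵒᵖ ↦ entry_ofEntry _ _ z.1.2 z.2.unop.2)
    fun (z w : Rows o × (Cols o)ᵒᵖ) f ↦ ?_
  have hwz := le_of_map (toSimplex o ho F) w.1.2 z.2.unop.2
  have hww := le_of_map (toSimplex o ho F) w.1.2 w.2.unop.2
  have h1 := rowCell_ofCells (ho _ _ (leOfHom f.1)) (ho _ _ hwz)
    (f := fun hi hj ↦ F.obj (⟨z.1, hi⟩, op ⟨z.2.unop, hj⟩))
    (g := fun hi hj ↦ F.obj (⟨z.1, hi⟩, op ⟨w.1, hj⟩))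
    (h := fun hi hj ↦ F.obj (⟨w.1, hi⟩, op ⟨z.2.unop, hj⟩))
    (fun _ _ _ ↦ F.map (step (leOfHom f.1) le_rfl)) (fun _ _ _ ↦ F.map (step le_rfl hwz))
    z.1.2 w.1.2 z.2.unop.2
  have h2 := colCell_ofCells (ho _ _ hww) (ho _ _ (leOfHom f.2.unop))
    (f := fun hi hj ↦ F.obj (⟨w.1, hi⟩, op ⟨z.2.unop, hj⟩))
    (g := fun hi hj ↦ F.obj (⟨w.1, hi⟩, op ⟨w.2.unop, hj⟩))
    (h := fun hi hj ↦ F.obj (⟨w.2.unop, hi⟩, op ⟨z.2.unop, hj⟩))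
    (fun _ _ _ ↦ F.map (step hww le_rfl)) (fun _ _ _ ↦ F.map (step le_rfl (leOfHom f.2.unop)))
    w.1.2 w.2.unop.2 z.2.unop.2
  refine (congrArg₂ (· ≫ ·) h1 h2).trans ?_
  simp only [Category.assoc, eqToHom_trans_assoc, eqToHom_refl, Category.id_comp]
  rw [← F.map_comp_assoc]
  rfl

theorem simplex_mk_congr {C : Type u} [Bicategory.{w, v} C] {o : Fin (n + 1) → C}
    {map map' : ∀ i j : Fin (n + 1), i ≤ j → (o i ⟶ o j)}
    {cell : ∀ (i j k : Fin (n + 1)) (hij : i ≤ j) (hjk : j ≤ k),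
      map i k (hij.trans hjk) ⟶ map i j hij ≫ map j k hjk}
    {cell' : ∀ (i j k : Fin (n + 1)) (hij : i ≤ j) (hjk : j ≤ k),
      map' i k (hij.trans hjk) ⟶ map' i j hij ≫ map' j k hjk} {h₁ h₂ h₃ h₄ h₁' h₂' h₃' h₄'}
    (hm : ∀ i j h, map i j h = map' i j h)
    (hc : ∀ i j k hij hjk,
      cell i j k hij hjk ≫ eqToHom (congrArg₂ (· ≫ ·) (hm i j hij) (hm j k hjk)) =
        eqToHom (hm i k (hij.trans hjk)) ≫ cell' i j k hij hjk) :
    Simplex.mk o map cell h₁ h₂ h₃ h₄ = Simplex.mk o map' cell' h₁' h₂' h₃' h₄' := by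
  obtain rfl : map = map' := by
    funext i j h
    exact hm i j h
  obtain rfl : cell = cell' := by
    funext i j k hij hjk
    simpa using hc i j k hij hjk
  rfl

theorem toSimplex_toFunctor (s : Simplex (Suspension D) n)
    (ho : ∀ i j, i ≤ j → vertex (s.obj i) ≤ vertex (s.obj j)) :
    toSimplex s.obj ho (toFunctor s) = s := by
  refine simplex_mk_congr (fun i j h ↦ ofEntry_entry (ho i j h) (s.map i j h)) fun i j k hij hjk ↦ ?_
  refine Eq.trans ?_ (ofCells_rowCell_colCell _ _ (s.cell i j k hij hjk)
    (congrArg₂ (· ≫ ·) (ofEntry_entry (ho i j hij) (s.map i j hij))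
      (ofEntry_entry (ho j k hjk) (s.map j k hjk))))
  congr 1
  congr 1
  · funext hi hj hk
    refine Eq.trans ?_ (Category.comp_id _)
    exact congrArg (_ ≫ ·) (colCell_right _ (s.map_self k) (s.cell_right j k hjk) hj hk)
  · funext hi hj hk
    refine Eq.trans ?_ (Category.id_comp _)
    exact congrArg (· ≫ _) (rowCell_left _ (s.map_self i) (s.cell_left i k _) hi hk)

theorem toSimplex_injective (o : Fin (n + 1) → Suspension D)
    (ho : ∀ i j, i ≤ j → vertex (o i) ≤ vertex (o j)) : Function.Injective (toSimplex o ho) := by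
  intro F G h
  -- `toFunctor s` has a type that depends on `s`, hence the heterogeneous equality.
  have key : ∀ s t : Simplex (Suspension D) n, s = t → HEq (toFunctor s) (toFunctor t) := by
    rintro s _ rfl
    rfl
  rw [← toFunctor_toSimplex o ho F, ← toFunctor_toSimplex o ho G]
  exact eq_of_heq (key _ _ h)

/-- Reindexing a simplex restricts its functor. This holds by definition, because rows and columns are
subtypes of `[n]`. -/
theorem toSimplex_reindex {m : ℕ} (o : Fin (n + 1) → Suspension D)
    (ho : ∀ i j, i ≤ j → vertex (o i) ≤ vertex (o j)) (F : Rows o × (Cols o)ᵒᵖ ⥤ D)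
    (θ : Fin (m + 1) →o Fin (n + 1)) :
    (toSimplex o ho F).reindex θ =
      toSimplex (o ∘ θ) (fun _ _ h ↦ ho _ _ (θ.monotone h))
        (restrict F (α' := Rows (o ∘ θ)) (β' := Cols (o ∘ θ))
          ⟨fun i ↦ ⟨θ i, i.2⟩, fun _ _ h ↦ θ.monotone h⟩
          ⟨fun j ↦ ⟨θ j, j.2⟩, fun _ _ h ↦ θ.monotone h⟩) :=
  rfl

end Functors

/-! ### The isomorphism between matrices and simplices -/

section Matrices

variable {D : Type u} {n : ℕ}

section Positions

variable {a b : ℕ} {o : Fin (n + 1) → Suspension D}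

theorem vertex_le_of_iff (H : ∀ i, o i = x ↔ (i : ℕ) < a) (i j : Fin (n + 1)) (h : i ≤ j) :
    vertex (o i) ≤ vertex (o j) := by
  rw [Fin.le_def] at h
  rcases eq_x_or_eq_y (o i) with hi | hi
  · rw [hi]
    exact Fin.zero_le _
  · have hj : o j = y := by
      rw [← ne_x_iff, ne_eq, H] at hi ⊢
      omega
    rw [hi, hj]

theorem eq_y_iff (H : ∀ i, o i = x ↔ (i : ℕ) < a) (i : Fin (n + 1)) : o i = y ↔ a ≤ (i : ℕ) := by
  rw [← ne_x_iff, ne_eq, H, not_lt]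

/-- If the first `a` vertices are exactly those equal to `x`, the rows are numbered by `Fin a`. -/
def rowPos (H : ∀ i, o i = x ↔ (i : ℕ) < a) : Rows o →o Fin a where
  toFun i := ⟨i, (H _).1 i.2⟩
  monotone' _ _ h := h

/-- The inverse of `rowPos`. -/
def rowIdx (hab : a + b = n + 1) (H : ∀ i, o i = x ↔ (i : ℕ) < a) : Fin a →o Rows o where
  toFun i := ⟨⟨i, by omega⟩, (H _).2 i.2⟩
  monotone' _ _ h := h

/-- If the last `b` vertices are exactly those equal to `y`, the columns are numbered by `Fin b`. -/
def colPos (hab : a + b = n + 1) (H : ∀ i, o i = x ↔ (i : ℕ) < a) : Cols o →o Fin b where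
  toFun j := ⟨j - a, by
    have := (eq_y_iff H _).1 j.2
    omega⟩
  monotone' _ _ h := Nat.sub_le_sub_right h a

/-- The inverse of `colPos`. -/
def colIdx (hab : a + b = n + 1) (H : ∀ i, o i = x ↔ (i : ℕ) < a) : Fin b →o Cols o where
  toFun j := ⟨⟨a + j, by omega⟩, (eq_y_iff H _).2 (Nat.le_add_right _ _)⟩
  monotone' _ _ h := Nat.add_le_add_left h a

theorem colPos_comp_colIdx (hab : a + b = n + 1) (H : ∀ i, o i = x ↔ (i : ℕ) < a) :
    (colPos hab H).comp (colIdx hab H) = OrderHom.id := by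
  ext j
  exact Nat.add_sub_cancel_left (n := a) (m := j)

theorem colIdx_comp_colPos (hab : a + b = n + 1) (H : ∀ i, o i = x ↔ (i : ℕ) < a) :
    (colIdx hab H).comp (colPos hab H) = OrderHom.id := by
  ext j
  exact Nat.add_sub_cancel' ((eq_y_iff H _).1 j.2)

variable [Category.{v} D]

/-- The simplex with vertices `o` that corresponds to a matrix. -/
def ofMatrix (hab : a + b = n + 1) (H : ∀ i, o i = x ↔ (i : ℕ) < a) (M : Fin a × (Fin b)ᵒᵖ ⥤ D) :
    Simplex (Suspension D) n :=
  toSimplex o (vertex_le_of_iff H) (restrict M (rowPos H) (colPos hab H))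

theorem ofMatrix_injective (hab : a + b = n + 1) (H : ∀ i, o i = x ↔ (i : ℕ) < a) :
    Function.Injective (ofMatrix (D := D) hab H) := by
  intro M N h
  have h' : restrict (restrict M (rowPos H) (colPos hab H)) (rowIdx hab H) (colIdx hab H) =
      restrict (restrict N (rowPos H) (colPos hab H)) (rowIdx hab H) (colIdx hab H) := by
    rw [toSimplex_injective _ _ h]
  change restrict M ((rowPos H).comp (rowIdx hab H)) ((colPos hab H).comp (colIdx hab H)) =
    restrict N ((rowPos H).comp (rowIdx hab H)) ((colPos hab H).comp (colIdx hab H)) at h'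
  rwa [colPos_comp_colIdx] at h'

theorem exists_ofMatrix_eq (s : Simplex (Suspension D) n) (hab : a + b = n + 1)
    (H : ∀ i, s.obj i = x ↔ (i : ℕ) < a) : ∃ M, ofMatrix hab H M = s := by
  refine ⟨restrict (toFunctor s) (rowIdx hab H) (colIdx hab H), ?_⟩
  change toSimplex _ _ (restrict (toFunctor s) ((rowIdx hab H).comp (rowPos H))
    ((colIdx hab H).comp (colPos hab H))) = s
  rw [colIdx_comp_colPos]
  exact toSimplex_toFunctor s _

/-- Naturality. The vertices `o'` of the target are a variable, equal to `o ∘ θ`, so that the equality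
of vertices can be substituted. -/
theorem ofMatrix_reindex {m a' b' : ℕ} {o' : Fin (m + 1) → Suspension D} (hab : a + b = n + 1)
    (H : ∀ i, o i = x ↔ (i : ℕ) < a) (M : Fin a × (Fin b)ᵒᵖ ⥤ D) (θ : Fin (m + 1) →o Fin (n + 1))
    (ho' : o' = o ∘ θ) (hab' : a' + b' = m + 1) (H' : ∀ i, o' i = x ↔ (i : ℕ) < a')
    (Hθ : ∀ i : Fin (m + 1), (i : ℕ) < a' ↔ (θ i : ℕ) < a) :
    (ofMatrix hab H M).reindex θ =
      ofMatrix hab' H' (Mat.pull M (Mat.rowMap θ hab hab' Hθ) (Mat.colMap θ hab hab' Hθ)) := by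
  subst ho'
  rw [ofMatrix, toSimplex_reindex, ofMatrix]
  congr 1
  -- Both sides restrict `M` along the same map of rows; a column `j` is recovered from its number
  -- as `a' + (j - a') = j`.
  refine congrArg (restrict (α' := Rows (o ∘ θ)) (β' := Cols (o ∘ θ)) M
    ⟨fun i ↦ ⟨θ i, (H _).1 i.2⟩, fun _ _ h ↦ θ.monotone h⟩)
    (?_ : (colPos hab H).comp (⟨fun j ↦ ⟨θ j, j.2⟩, fun _ _ h ↦ θ.monotone h⟩ :
      Cols (o ∘ θ) →o Cols o) = (Mat.colMap θ hab hab' Hθ).comp (colPos hab' H'))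
  ext j
  have hj : a' + ((j : Fin (m + 1)) - a' : ℕ) = (j : Fin (m + 1)) :=
    Nat.add_sub_cancel' ((eq_y_iff H' _).1 j.2)
  change (θ j : ℕ) - a = θ ⟨a' + ((j : Fin (m + 1)) - a' : ℕ), _⟩ - a
  simp only [hj]

end Positions

/-- The vertices of an `n`-simplex whose first `a` vertices are `x`. -/
def vertices (D : Type u) (n a : ℕ) (i : Fin (n + 1)) : Suspension D :=
  if (i : ℕ) < a then x else y

theorem vertices_eq_x_iff (a : ℕ) (i : Fin (n + 1)) : vertices D n a i = x ↔ (i : ℕ) < a := by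
  rw [vertices]
  split_ifs with h <;> simp [h]

theorem eq_vertices {o : Fin (n + 1) → Suspension D} {a : ℕ} (H : ∀ i, o i = x ↔ (i : ℕ) < a) :
    o = vertices D n a := by
  funext i
  rw [vertices]
  split_ifs with h
  · exact (H i).2 h
  · exact ne_x_iff.1 (mt (H i).1 h)

theorem eq_of_vertices {o : Fin (n + 1) → Suspension D} {a a' : ℕ} (ha : a ≤ n + 1)
    (ha' : a' ≤ n + 1) (H : ∀ i, o i = x ↔ (i : ℕ) < a) (H' : ∀ i, o i = x ↔ (i : ℕ) < a') :
    a = a' := by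
  by_contra hne
  have h := (H ⟨min a a', by omega⟩).symm.trans (H' ⟨min a a', by omega⟩)
  simp only at h
  omega

variable [Category.{v} D]

variable (D) in
/-- The map that sends a matrix with `k + 1` rows to the simplex whose first `k + 1` vertices are `x` and
whose edges from `x` to `y` are the entries of the matrix. -/
def matToNerve : Mat.sSet D ⟶ duskinNerve (Suspension D) where
  app n := TypeCat.ofHom fun (M : Mat D n.unop.len) ↦
    ofMatrix M.total (vertices_eq_x_iff M.rows) M.entries
  naturality n m f := by
    ext M
    refine (ofMatrix_reindex _ _ _ f.unop.toOrderHom (funext fun i ↦ ?_) _ _ _).symm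
    exact if_congr (Mat.lt_cut_iff f.unop.toOrderHom M.rows i) rfl rfl

/-- The number `a` of vertices equal to `x` is the position of the first vertex equal to `y`. -/
theorem exists_vertices (s : Simplex (Suspension D) n) :
    ∃ a b, a + b = n + 1 ∧ ∀ i, s.obj i = x ↔ (i : ℕ) < a := by
  classical
  have key : ∃ a ≤ n + 1, ∀ i, s.obj i = x ↔ (i : ℕ) < a := by
    by_cases hx : ∀ i, s.obj i = x
    · exact ⟨n + 1, le_rfl, fun i ↦ by simp only [hx i, i.2]⟩
    · have hx' : ∃ k, ∃ h : k < n + 1, s.obj ⟨k, h⟩ = y := by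
        push Not at hx
        obtain ⟨i, hi⟩ := hx
        exact ⟨i, i.2, ne_x_iff.1 hi⟩
      obtain ⟨hlt, hy⟩ := Nat.find_spec hx'
      refine ⟨Nat.find hx', hlt.le, fun i ↦ ⟨fun hi ↦ ?_, fun hi ↦ ?_⟩⟩
      · refine lt_of_le_of_ne (Fin.le_def.1 (le_of_map s hi hy)) fun h ↦ ?_
        have : i = ⟨Nat.find hx', hlt⟩ := Fin.ext h
        rw [this, hy] at hi
        cases hi
      · by_contra hne
        exact Nat.find_min hx' hi ⟨i.2, ne_x_iff.1 hne⟩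
  obtain ⟨a, ha, H⟩ := key
  exact ⟨a, n + 1 - a, by omega, H⟩

theorem exists_app_eq (s : Simplex (Suspension D) n) {a b : ℕ} (hab : a + b = n + 1)
    (H : ∀ i, s.obj i = x ↔ (i : ℕ) < a) :
    ∃ M : Fin a × (Fin b)ᵒᵖ ⥤ D,
      (matToNerve D).app (op (SimplexCategory.mk n)) (⟨a, b, hab, M⟩ : Mat D n) = s := by
  obtain ⟨M, hM⟩ := exists_ofMatrix_eq s hab H
  refine ⟨M, Eq.trans ?_ hM⟩
  change ofMatrix hab (vertices_eq_x_iff a) M = ofMatrix hab H M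
  have key : ∀ (o : Fin (n + 1) → Suspension D) (h : ∀ i, o i = x ↔ (i : ℕ) < a),
      ofMatrix hab (vertices_eq_x_iff a) M = ofMatrix hab h M := by
    intro o h
    obtain rfl := eq_vertices h
    rfl
  exact key _ H

theorem matToNerve_app_bijective (n : SimplexCategoryᵒᵖ) :
    Function.Bijective ((matToNerve D).app n) := by
  constructor
  · rintro ⟨a, b, hab, M⟩ ⟨a', b', hab', M'⟩ h
    have hobj : vertices D n.unop.len a = vertices D n.unop.len a' := congrArg Simplex.obj h
    obtain rfl : a = a' := eq_of_vertices (by omega)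
      (hab' ▸ Nat.le_add_right _ _) (vertices_eq_x_iff (D := D) a)
      fun i ↦ by rw [hobj, vertices_eq_x_iff]
    obtain rfl : b = b' := by omega
    exact congrArg (Mat.mk a b hab) (ofMatrix_injective hab (vertices_eq_x_iff a) h)
  · intro s
    obtain ⟨a, b, hab, H⟩ := exists_vertices s
    obtain ⟨M, hM⟩ := exists_app_eq s hab H
    exact ⟨_, hM⟩

instance isIso_matToNerve : IsIso (matToNerve D) :=
  haveI : ∀ n, IsIso ((matToNerve D).app n) := fun n ↦
    (isIso_iff_bijective _).2 (matToNerve_app_bijective n)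
  NatIso.isIso_of_isIso_app _

theorem matToNerve_toInterval : matToNerve D ≫ toInterval D = Mat.toInterval D := by
  ext n M
  apply SSet.stdSimplex.objEquiv.injective
  ext i
  change (vertex (vertices D n.unop.len (Mat.rows M) i) : ℕ) =
    ((if (i : ℕ) < Mat.rows M then 0 else 1 : Fin 2) : ℕ)
  rw [vertices]
  split_ifs <;> rfl

end Matrices

/-! ### The type of a simplex -/

section Types

variable {D : Type u} [Category.{v} D] {n : ℕ}

instance subsingleton_hom (c : Suspension D) : Subsingleton (c ⟶ c) := by
  cases c <;> exact inferInstanceAs (Subsingleton PUnit)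

instance subsingleton_cell (c : Suspension D) (f g : c ⟶ c) : Subsingleton (f ⟶ g) := by
  cases c <;> exact inferInstanceAs (Subsingleton PUnit)

theorem eq_of_obj_eq_const {c : Suspension D} {s t : Simplex (Suspension D) n}
    (hs : ∀ i, s.obj i = c) (ht : ∀ i, t.obj i = c) : s = t := by
  obtain ⟨o, _, _, _, _, _, _⟩ := s
  obtain ⟨o', _, _, _, _, _, _⟩ := t
  obtain rfl : o = fun _ ↦ c := funext hs
  obtain rfl : o' = fun _ ↦ c := funext ht
  exact simplex_mk_congr (fun _ _ _ ↦ Subsingleton.elim _ _) fun _ _ _ _ _ ↦ Subsingleton.elim _ _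

theorem isConstantAt_iff (s : Simplex (Suspension D) n) (c : Suspension D) :
    IsConstantAt (n := n) s c ↔ ∀ i, s.obj i = c := by
  constructor
  · rintro ⟨s₀, h₀, rfl⟩ i
    exact h₀
  · intro h
    exact ⟨s.reindex ⟨fun _ ↦ 0, fun _ _ _ ↦ le_rfl⟩, h 0,
      eq_of_obj_eq_const (c := c) h fun _ ↦ h 0⟩

/-- An edge is degenerate exactly if its endpoints agree, because the endomorphisms in `ΣD` are
trivial. -/
theorem mem_nonDegenerate_one_iff (e : Simplex (Suspension D) 1) :
    e ∈ (duskinNerve (Suspension D)).nonDegenerate 1 ↔ e.obj 0 = x ∧ e.obj 1 = y := by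
  refine (SSet.mem_nonDegenerate_iff_notMem_degenerate _ _).trans (not_iff_comm.1 ?_)
  constructor
  · intro h
    have h01 : e.obj 0 = e.obj 1 := by
      rcases eq_x_or_eq_y (e.obj 0) with h0 | h0 <;> rcases eq_x_or_eq_y (e.obj 1) with h1 | h1
      · rw [h0, h1]
      · exact absurd ⟨h0, h1⟩ h
      · exact absurd (le_of_map e h1 h0) (by decide)
      · rw [h0, h1]
    obtain ⟨s₀, _, hs⟩ := (isConstantAt_iff e (e.obj 0)).2 fun i ↦ by
      fin_cases i
      · rfl
      · exact h01.symm
    exact ⟨0, zero_lt_one, _, s₀, hs.symm⟩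
  · rintro ⟨m, hm, f, s₀, rfl⟩ ⟨h0, h1⟩
    obtain rfl : m = 0 := by omega
    have h : f.toOrderHom 0 = f.toOrderHom 1 := Subsingleton.elim (α := Fin 1) _ _
    change Simplex.obj s₀ (f.toOrderHom 0) = x at h0
    change Simplex.obj s₀ (f.toOrderHom 1) = y at h1
    rw [h, h1] at h0
    cases h0

/-- A simplex is of type `k` exactly if its first `k + 1` vertices, and no others, are `x`. -/
theorem isOfType_iff (s : Simplex (Suspension D) n) {a : ℕ} (ha : a ≤ n + 1) :
    IsOfType (n := n) s ((a : ℤ) - 1) ↔ ∀ i, s.obj i = x ↔ (i : ℕ) < a := by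
  have hedge : ∀ i : Fin n, (duskinNerve (Suspension D)).map (SimplexCategory.mkOfSucc i).op s ∈
      (duskinNerve (Suspension D)).nonDegenerate 1 ↔ s.obj i.castSucc = x ∧ s.obj i.succ = y :=
    fun i ↦ mem_nonDegenerate_one_iff (s.reindex (SimplexCategory.mkOfSucc i).toOrderHom)
  simp only [IsOfType, hedge, isConstantAt_iff]
  constructor
  · rintro (⟨hk, h⟩ | ⟨k, hk, h0, h1⟩ | ⟨hk, h⟩) i
    · simp only [h i, reduceCtorEq, false_iff]
      omega
    · have h2 : i ≤ k.castSucc → s.obj i = x := fun hi ↦ by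
        by_contra hne
        obtain rfl := le_antisymm hi (le_of_map s h0 (ne_x_iff.1 hne))
        exact hne h0
      have h3 : s.obj i = x → i ≤ k.succ := fun hi ↦ le_of_map s hi h1
      have h4 : i = k.succ → s.obj i ≠ x := by
        rintro rfl
        exact ne_x_iff.2 h1
      simp only [Fin.le_def, Fin.ext_iff, Fin.val_castSucc, Fin.val_succ] at h2 h3 h4
      refine ⟨fun hi ↦ ?_, fun hi ↦ h2 (by omega)⟩
      have := h3 hi
      have : (i : ℕ) ≠ k + 1 := fun h ↦ h4 h hi
      omega
    · simp only [h i, true_iff]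
      omega
  · intro H
    have H' := eq_y_iff H
    rcases Nat.eq_zero_or_pos a with rfl | hpos
    · exact Or.inl ⟨by simp, fun i ↦ (H' i).2 (Nat.zero_le _)⟩
    · rcases ha.eq_or_lt with rfl | hlt
      · exact Or.inr (Or.inr ⟨by simp, fun i ↦ (H i).2 i.2⟩)
      · refine Or.inr (Or.inl ⟨⟨a - 1, by omega⟩, ?_, (H _).2 ?_, (H' _).2 ?_⟩)
        all_goals simp
        all_goals omega

end Types

end Suspension

end DuskinNerve

theorem theorem1 (D : Type u) [Category.{v} D] :
    ∃ Φ : DuskinNerve.Mat.sSet D ≅ DuskinNerve.duskinNerve (DuskinNerve.Suspension D),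
      Φ.hom ≫ DuskinNerve.Suspension.toInterval D = DuskinNerve.Mat.toInterval D ∧
      (∀ (n : ℕ) (s : (DuskinNerve.duskinNerve (DuskinNerve.Suspension D)).obj
          (op (SimplexCategory.mk n))),
        ∃! M : DuskinNerve.Mat D n, Φ.hom.app (op (SimplexCategory.mk n)) M = s) ∧
      (∀ (n a b : ℕ) (h : a + b = n + 1),
        Set.BijOn
          (fun M : Fin a × (Fin b)ᵒᵖ ⥤ D ↦
            Φ.hom.app (op (SimplexCategory.mk n)) (⟨a, b, h, M⟩ : DuskinNerve.Mat D n))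
          Set.univ
          {s | DuskinNerve.Suspension.IsOfType s ((a : ℤ) - 1)}) := by
  open DuskinNerve Suspension in
  refine ⟨asIso (matToNerve D), matToNerve_toInterval, fun n ↦
    (Function.bijective_iff_existsUnique _).1 (matToNerve_app_bijective _), fun n a b h ↦
    ⟨fun M _ ↦ ?_, fun M _ N _ hMN ↦ ?_, fun s hs ↦ ?_⟩⟩
  · exact (isOfType_iff (ofMatrix h (vertices_eq_x_iff a) M)
      (h ▸ Nat.le_add_right a b)).2 (vertices_eq_x_iff a)
  · exact ofMatrix_injective h (vertices_eq_x_iff a) hMN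
  · obtain ⟨M, hM⟩ := exists_app_eq s h ((isOfType_iff s (h ▸ Nat.le_add_right a b)).1 hs)
    exact ⟨M, trivial, hM⟩
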